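/- Let $N\ge 1$ and let $w:\mathbb C\setminus\{0\}\to GL(N,\mathbb C)$ be holomorphic and single-valued. Let $\mathrm d\mu=w\,\mathrm dm$ be the associated matrix of measures on the unit circle $\mathbb T$, where $\mathrm dm(\zeta)=\frac{\mathrm d\zeta}{2\pi \mathrm i\zeta}$. Assume that $\mu$ is quasi-definite: with the moments $\hat\mu(j)=\oint_{\mathbb T}\bar\zeta^{\,j}\mathrm d\mu(\zeta)$, $j\in\mathbb Z$, the block Toeplitz matrices $(\hat\mu(i-j))_{i,j=0}^{n-1}$ and $(\hat\mu(j-i))_{i,j=0}^{n-1}$ are non-singular for every $n\ge1$. For $n\ge 0$ let $P^L_{1,n}$ and $P^R_{2,n}$ be the Szegő matrix polynomials, i.e. the monic matrix polynomials of degree $n$ with $$\oint_{\mathbb T}P^L_{1,n}(\zeta)\,\mathrm d\mu(\zeta)\,\bar\zeta^{\,j}=0,\qquad \oint_{\mathbb T}\big(P^R_{2,n}(\zeta)\big)^\dagger\,\mathrm d\mu(\zeta)\,\zeta^{j}=0,\qquad 0\le j\le n-1,$$ and let $\alpha^L_{1,n}=P^L_{1,n}(0)$ and $\alpha^R_{2,n}=P^R_{2,n}(0)$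 be the Verblunsky matrices (so $\alpha^L_{1,0}=\alpha^R_{2,0}=I_N$). Suppose that the right logarithmic derivative of $w$ is $$\frac{\mathrm dw(z)}{\mathrm dz}\,w(z)^{-1}=W_{-1}z^{-1}+W_0+W_1z,\qquad z\in\mathbb C\setminus\{0\},$$ with $W_{-1},W_0,W_1\in\mathbb C^{N\times N}$ and $W_{-1}$ diagonalizable with integer eigenvalues. Then, for every $n\in\{1,2,\dots\}$, $$W_{0}\alpha^L_{1,n}+W_1\alpha^L_{1,n+1}-\alpha^L_{1,n-1}\big(W_{-1}-(n-1)I_N\big)=W_1\Big(\alpha^L_{1,n+1}\big(\alpha^R_{2,n}\big)^\dagger\alpha^L_{1,n}+\alpha^L_{1,n}\big(\alpha^R_{2,n-1}\big)^\dagger\alpha^L_{1,n}\Big)+\Big[W_1,\sum_{m=1}^{n-1}\alpha^L_{1,m}\big(\alpha^R_{2,m-1}\big)^\dagger\Big]\alpha^L_{1,n}$$ and $$\big(\alpha^R_{2,n}\big)^\dagger W_{0}+\big(\alpha^R_{2,n-1}\big)^\dagger W_1-\big(W_{-1}-(n+1)I_N\big)\big(\alpha^R_{2,n+1}\big)^\dagger=\Big(\big(\alpha^R_{2,n}\big)^\dagger\alpha^L_{1,n}\big(\alpha^R_{2,n-1}\big)^\dagger+\big(\alpha^R_{2,n}\big)^\dagger\alpha^L_{1,n+1}\big(\alpha^R_{2,n}\big)^\dagger\Big)W_1+\big(\alpha^R_{2,n}\big)^\dagger\Big[W_1,\sum_{m=1}^{n+1}\alpha^L_{1,m}\big(\alpha^R_{2,m-1}\big)^\dagger\Big].$$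 -/

import Mathlib

open scoped Matrix Polynomial BigOperators

/-- Entrywise integral `∮ F(ζ) dm(ζ)` over the positively oriented unit circle of a matrix valued
function, with respect to the normalized Lebesgue measure `dm(ζ) = dζ / (2πiζ)`. -/
noncomputable def circleMean {ι κ : Type*} (F : ℂ → Matrix ι κ ℂ) : Matrix ι κ ℂ :=
  Matrix.of fun i j => (2 * (Real.pi : ℂ) * Complex.I)⁻¹ * ∮ ζ in C(0, 1), ζ⁻¹ * F ζ i j

/-- The value `P(z) = ∑ₖ zᵏ Pₖ` at a complex number `z` of a polynomial with matrix coefficients. -/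
noncomputable def matPolyEval {N : ℕ} (P : (Matrix (Fin N) (Fin N) ℂ)[X]) (z : ℂ) :
    Matrix (Fin N) (Fin N) ℂ :=
  P.eval (Matrix.scalar (Fin N) z)

/-- The moments `∮ ζ̄ʲ dμ(ζ)`, `j ∈ ℤ`, of the matrix of measures `dμ = w dm`. -/
noncomputable def weightMoment {N : ℕ} (w : ℂ → Matrix (Fin N) (Fin N) ℂ) (j : ℤ) :
    Matrix (Fin N) (Fin N) ℂ :=
  circleMean fun ζ => (starRingEnd ℂ ζ) ^ j • w ζ

/-- The truncated left moment matrix: the `n × n` block matrix with `(i, j)` block the moment of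
index `i - j`. -/
noncomputable def leftMomentMatrix {N : ℕ} (w : ℂ → Matrix (Fin N) (Fin N) ℂ) (n : ℕ) :
    Matrix (Fin n × Fin N) (Fin n × Fin N) ℂ :=
  Matrix.of fun p q => weightMoment w ((p.1 : ℤ) - (q.1 : ℤ)) p.2 q.2

/-- The truncated right moment matrix: the `n × n` block matrix with `(i, j)` block the moment of
index `j - i`. -/
noncomputable def rightMomentMatrix {N : ℕ} (w : ℂ → Matrix (Fin N) (Fin N) ℂ) (n : ℕ) :
    Matrix (Fin n × Fin N) (Fin n × Fin N) ℂ :=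
  Matrix.of fun p q => weightMoment w ((q.1 : ℤ) - (p.1 : ℤ)) p.2 q.2

/-- Quasi-definiteness of the matrix of measures `dμ = w dm`. -/
def IsQuasiDefinite {N : ℕ} (w : ℂ → Matrix (Fin N) (Fin N) ℂ) : Prop :=
  ∀ n : ℕ, 1 ≤ n → (leftMomentMatrix w n).det ≠ 0 ∧ (rightMomentMatrix w n).det ≠ 0

/-- `P` is the left monic Szegő matrix polynomial of the first family, of degree `n`. -/
def IsLeftSzegoOne {N : ℕ} (w : ℂ → Matrix (Fin N) (Fin N) ℂ) (n : ℕ)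
    (P : (Matrix (Fin N) (Fin N) ℂ)[X]) : Prop :=
  P.IsMonicOfDegree n ∧
    ∀ j : ℕ, j < n →
      circleMean (fun ζ => (starRingEnd ℂ ζ) ^ j • (matPolyEval P ζ * w ζ)) = 0

/-- `P` is the right monic Szegő matrix polynomial of the second family, of degree `n`. -/
def IsRightSzegoTwo {N : ℕ} (w : ℂ → Matrix (Fin N) (Fin N) ℂ) (n : ℕ)
    (P : (Matrix (Fin N) (Fin N) ℂ)[X]) : Prop :=
  P.IsMonicOfDegree n ∧
    ∀ j : ℕ, j < n → circleMean (fun ζ => ζ ^ j • ((matPolyEval P ζ)ᴴ * w ζ)) = 0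

/-- The Verblunsky matrix of a Szegő polynomial: its value at the origin. -/
noncomputable def verblunsky {N : ℕ} (P : (Matrix (Fin N) (Fin N) ℂ)[X]) :
    Matrix (Fin N) (Fin N) ℂ :=
  matPolyEval P 0

/-- `w` is holomorphic on the punctured plane `ℂ \ {0}`, with invertible values there. -/
def IsHolomorphicWeight {N : ℕ} (w : ℂ → Matrix (Fin N) (Fin N) ℂ) : Prop :=
  (∀ i j, DifferentiableOn ℂ (fun z => w z i j) {0}ᶜ) ∧ ∀ z : ℂ, z ≠ 0 → IsUnit (w z)

/-- The right logarithmic derivative `w'(z) w(z)⁻¹`. -/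
noncomputable def rightLogDeriv {N : ℕ} (w : ℂ → Matrix (Fin N) (Fin N) ℂ) (z : ℂ) :
    Matrix (Fin N) (Fin N) ℂ :=
  (Matrix.of fun i j => deriv (fun ζ => w ζ i j) z) * (w z)⁻¹

/-- `A` is diagonalizable with integer eigenvalues. -/
def IsDiagonalizableInt {N : ℕ} (A : Matrix (Fin N) (Fin N) ℂ) : Prop :=
  ∃ (S : Matrix (Fin N) (Fin N) ℂ) (l : Fin N → ℤ),
    IsUnit S ∧ A = S * Matrix.diagonal (fun i => (l i : ℂ)) * S⁻¹

/-! On the unit circle `ζ̄ = ζ⁻¹`, so all the orthogonality conditions become conditions on the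
two-sided moment sequence `c`, and the argument is algebra over a noncommutative ring. The only
analytic input is that the total derivative of `ζ^(-j) w` has zero integral; with the equation for
`w'` this gives `a c_j + b c_{j-1} + d c_{j-2} = j c_j` (`weightMoment_recurrence`). Equivalently,
the operator `L P = z P' + P (a + b z + d z²)` multiplies the `j`-th pairing of `P` by `j`, so it
preserves orthogonality relations.

Hence `L (P n)`, of degree at most `n + 2`, is a left combination of `P n`, `P (n + 1)`, `P (n + 2)`
(`logDerivOp_orthogonal`), and the reversed polynomials satisfy a similar identity
(`logDerivOp_reversed`). The constant coefficient of the first identity and the top coefficient of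
the second are the two claimed relations. The sums of products of Verblunsky matrices enter as
subleading coefficients, computed from the Szegő recursions; the commutators arise because these
sums appear on both sides of `d`. -/

open Polynomial in
/-- The pairing `∑ₖ Pₖ c_{j-k}` of a polynomial `P` with a two-sided sequence of moments `c`. -/
noncomputable def momentPairing {A : Type*} [Ring A] (c : ℤ → A) (j : ℤ) : A[X] →+ A where
  toFun P := P.sum fun k a => a * c (j - k)
  map_zero' := by simp
  map_add' P Q := by
    rw [sum_add_index] <;> simp [add_mul]

/-- The operator `P ↦ z P' + P (a + b z + d z²)`: the logarithmic derivative `z d/dz` acting on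
`P w` when `z w' = (a + b z + d z²) w`. -/
noncomputable def logDerivOp {A : Type*} [Ring A] (a b d : A) (P : A[X]) : A[X] :=
  Polynomial.derivative P * Polynomial.X + P * Polynomial.C a + P * Polynomial.C b * Polynomial.X
    + P * Polynomial.C d * Polynomial.X ^ 2

/-! ### Shift rules for the moment pairing. -/

namespace momentPairing

open Polynomial

variable {A : Type*} [Ring A] (c : ℤ → A)

lemma apply_eq_sum_range (P : A[X]) (j : ℤ) {n : ℕ} (h : P.natDegree < n) :
    momentPairing c j P = ∑ k ∈ Finset.range n, P.coeff k * c (j - k) :=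
  Polynomial.sum_over_range' P (f := fun k a => a * c (j - k)) (fun _ => zero_mul _) n h

lemma apply_monomial (k : ℕ) (a : A) (j : ℤ) :
    momentPairing c j (monomial k a) = a * c (j - k) :=
  sum_monomial_index (n := k) a (fun k a => a * c (j - k)) (zero_mul _)

lemma C_mul (a : A) (P : A[X]) (j : ℤ) :
    momentPairing c j (C a * P) = a * momentPairing c j P := by
  induction P using Polynomial.induction_on' with
  | add P Q hP hQ => simp only [mul_add, map_add, hP, hQ]
  | monomial k b => simp [C_mul_monomial, apply_monomial, mul_assoc]

lemma mul_X (P : A[X]) (j : ℤ) :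
    momentPairing c j (P * X) = momentPairing c (j - 1) P := by
  induction P using Polynomial.induction_on' with
  | add P Q hP hQ => simp only [add_mul, map_add, hP, hQ]
  | monomial k b =>
    rw [monomial_mul_X, apply_monomial, apply_monomial]
    congr 2; push_cast; ring

/-- On a monomial of degree `k`, the recurrence at index `j - k` produces the factor `j - k`, and `z
P'` supplies the missing `k`. -/
lemma logDerivOp {a b d : A}
    (hc : ∀ j : ℤ, a * c j + b * c (j - 1) + d * c (j - 2) = (j : A) * c j) (P : A[X]) (j : ℤ) :
    momentPairing c j (logDerivOp a b d P) = (j : A) * momentPairing c j P := by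
  induction P using Polynomial.induction_on' with
  | add P Q hP hQ =>
    have : _root_.logDerivOp a b d (P + Q)
        = _root_.logDerivOp a b d P + _root_.logDerivOp a b d Q := by
      simp only [_root_.logDerivOp, add_mul, map_add]; abel
    rw [this, map_add, map_add, hP, hQ, mul_add]
  | monomial k p =>
    have h1 : derivative (monomial k p) * X = monomial k (p * (k : A)) := by
      rw [derivative_monomial]
      rcases k with _ | k
      · simp
      · simp
    have h := hc (j - k)
    simp only [_root_.logDerivOp, h1, map_add, monomial_mul_C, pow_two, ← mul_assoc, mul_X,
      apply_monomial]
    have e1 : j - 1 - (k : ℤ) = j - k - 1 := by ring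
    have e2 : j - 1 - 1 - (k : ℤ) = j - k - 2 := by ring
    rw [e1, e2, (Int.cast_commute j p).eq, mul_assoc p (j : A)]
    have h3 : (j : A) = ((j - k : ℤ) : A) + (k : A) := by push_cast; exact (sub_add_cancel _ _).symm
    rw [h3, add_mul, ← h]
    noncomm_ring

end momentPairing

/-! ### Szegő recursions and their compatibility with the Pearson equation, over a ring. -/

section SzegoAlgebra

open Polynomial

variable {A : Type*} [Ring A] {c : ℤ → A} {P R : ℕ → A[X]}

/-- The moments are nondegenerate: a polynomial of degree `< n` orthogonal to the first `n`
powers vanishes. -/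
def MomentNondegenerate (c : ℤ → A) : Prop :=
  ∀ (n : ℕ) (S : A[X]), (∀ k, n ≤ k → S.coeff k = 0) →
    (∀ j : ℕ, j < n → momentPairing c j S = 0) → S = 0

/-- `P n` is monic of degree `n` and orthogonal to the powers `0, …, n - 1`. -/
structure IsMonicOrthogonal (c : ℤ → A) (P : ℕ → A[X]) : Prop where
  coeff_eq_zero : ∀ n k, n < k → (P n).coeff k = 0
  coeff_self : ∀ n, (P n).coeff n = 1
  pairing : ∀ n j : ℕ, j < n → momentPairing c j (P n) = 0

/-- `R n` has degree at most `n`, constant term `1`, and is orthogonal to the powers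
`1, …, n`. -/
structure IsReversedOrthogonal (c : ℤ → A) (R : ℕ → A[X]) : Prop where
  coeff_eq_zero : ∀ n k, n < k → (R n).coeff k = 0
  coeff_zero : ∀ n, (R n).coeff 0 = 1
  pairing : ∀ n j : ℕ, j < n → momentPairing c (j + 1 : ℤ) (R n) = 0

/-- Dividing by `X` lowers both the degree and the pairing index by one. This is the form of
uniqueness suited to reversed polynomials, which are orthogonal to the powers starting at `1`. -/
lemma MomentNondegenerate.eq_zero_of_shift (hN : MomentNondegenerate c) (n : ℕ) (S : A[X])
    (h0 : S.coeff 0 = 0) (hS : ∀ k, n ≤ k → S.coeff (k + 1) = 0)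
    (h : ∀ j : ℕ, j < n → momentPairing c (j + 1 : ℤ) S = 0) : S = 0 := by
  have hd : S = S.divX * X := by
    conv_lhs => rw [← divX_mul_X_add S, h0]
    simp
  have : S.divX = 0 := by
    refine hN n _ (fun k hk => by rw [coeff_divX]; exact hS k hk) fun j hj => ?_
    have := h j hj
    rwa [hd, momentPairing.mul_X, add_sub_cancel_right] at this
  rw [hd, this, zero_mul]

variable (hN : MomentNondegenerate c) (hP : IsMonicOrthogonal c P) (hR : IsReversedOrthogonal c R)
include hN hP hR

/-- The Szegő recursion for the monic orthogonal polynomials. -/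
lemma szego_recursion (n : ℕ) :
    P (n + 1) = P n * X + C ((P (n + 1)).coeff 0) * R n := by
  rw [← sub_eq_zero]
  refine hN.eq_zero_of_shift n _ ?_ (fun k hk => ?_) fun j hj => ?_
  · simp [hR.coeff_zero]
  · simp only [coeff_sub, coeff_add, coeff_mul_X, coeff_C_mul,
      hR.coeff_eq_zero n (k + 1) (by omega)]
    rcases hk.eq_or_lt with rfl | hk
    · simp [hP.coeff_self]
    · simp [hP.coeff_eq_zero n k hk, hP.coeff_eq_zero (n + 1) (k + 1) (by omega)]
  · have h1 := hP.pairing (n + 1) (j + 1) (by omega)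
    push_cast at h1
    simp [momentPairing.mul_X, momentPairing.C_mul, h1, hP.pairing n j hj, hR.pairing n j hj]

/-- The Szegő recursion for the reversed polynomials. -/
lemma szego_recursion_reversed (n : ℕ) :
    R (n + 1) = R n + C ((R (n + 1)).coeff (n + 1)) * P n * X := by
  rw [← sub_eq_zero]
  refine hN.eq_zero_of_shift n _ ?_ (fun k hk => ?_) fun j hj => ?_
  · simp [hR.coeff_zero]
  · simp only [coeff_sub, coeff_add, coeff_mul_X, coeff_C_mul,
      hR.coeff_eq_zero n (k + 1) (by omega)]
    rcases hk.eq_or_lt with rfl | hk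
    · simp [hP.coeff_self]
    · simp [hP.coeff_eq_zero n k hk, hR.coeff_eq_zero (n + 1) (k + 1) (by omega)]
  · simp [momentPairing.mul_X, momentPairing.C_mul, hR.pairing (n + 1) j (by omega),
      hP.pairing n j hj, hR.pairing n j hj]

/-- Each Szegő step shifts the subleading coefficient and adds one product of Verblunsky
coefficients, so the recursion telescopes. -/
lemma coeff_pred_eq_sum (n : ℕ) :
    (P (n + 1)).coeff n =
      ∑ m ∈ Finset.Icc 1 (n + 1), (P m).coeff 0 * (R (m - 1)).coeff (m - 1) := by
  induction n with
  | zero =>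
    simp [hR.coeff_zero]
  | succ n ih =>
    rw [Finset.sum_Icc_succ_top (by omega), ← ih, szego_recursion hN hP hR (n + 1)]
    simp [hR.coeff_zero]

lemma reversed_coeff_pred (n : ℕ) :
    (R (n + 1)).coeff n = (R n).coeff n + (R (n + 1)).coeff (n + 1) *
      ∑ m ∈ Finset.Icc 1 n, (P m).coeff 0 * (R (m - 1)).coeff (m - 1) := by
  conv_lhs => rw [szego_recursion_reversed hN hP hR n]
  rcases n with _ | n
  · simp
  · rw [← coeff_pred_eq_sum hN hP hR]
    simp [mul_assoc]

variable {a b d : A}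

/-- The coefficients of `P (n + 2)` and `P (n + 1)` are forced by degrees `n + 2` and `n + 1`. The
remainder then has degree at most `n`, and nondegeneracy kills it once it pairs to zero with `0, …,
n`. -/
lemma logDerivOp_orthogonal
    (hc : ∀ j : ℤ, a * c j + b * c (j - 1) + d * c (j - 2) = (j : A) * c j) (n : ℕ) :
    logDerivOp a b d (P n) = C d * P (n + 2)
      + C (b + (∑ m ∈ Finset.Icc 1 n, (P m).coeff 0 * (R (m - 1)).coeff (m - 1)) * d
        - d * ∑ m ∈ Finset.Icc 1 (n + 2), (P m).coeff 0 * (R (m - 1)).coeff (m - 1)) * P (n + 1)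
      + C (n : A) * P n := by
  rw [← sub_eq_zero]
  refine hN (n + 1) _ (fun k hk => ?_) fun j hj => ?_
  · obtain ⟨k, rfl⟩ := Nat.exists_eq_add_of_le' hk
    have hd : (derivative (P n) * X).coeff (k + n + 1) = 0 := by
      simp [coeff_derivative, hP.coeff_eq_zero n (k + n + 1) (by omega)]
    rw [← add_assoc, coeff_sub]
    unfold logDerivOp
    simp only [coeff_add, hd, coeff_C_mul, coeff_mul_C, coeff_mul_X,
      hP.coeff_eq_zero n (k + n + 1) (by omega)]
    match k with
    | 0 =>
      have e := coeff_pred_eq_sum hN hP hR (n + 1)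
      rw [Nat.zero_add n, show n + 2 = n + 1 + 1 from rfl, e, hP.coeff_self, hP.coeff_self]
      have : (P n * C d * X ^ 2).coeff (n + 1)
          = (∑ m ∈ Finset.Icc 1 n, (P m).coeff 0 * (R (m - 1)).coeff (m - 1)) * d := by
        rw [pow_two, ← mul_assoc, coeff_mul_X]
        rcases n with _ | n
        · simp
        · rw [coeff_mul_X, coeff_mul_C, coeff_pred_eq_sum hN hP hR]
      rw [this]
      noncomm_ring
    | 1 =>
      rw [show 1 + n + 1 = n + 2 by ring, coeff_mul_X_pow, coeff_mul_C, hP.coeff_self,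
        hP.coeff_self, hP.coeff_eq_zero n (1 + n) (by omega),
        hP.coeff_eq_zero (n + 1) (n + 2) (by omega)]
      simp
    | k + 2 =>
      rw [show k + 2 + n + 1 = k + 1 + n + 2 by ring, coeff_mul_X_pow, coeff_mul_C,
        hP.coeff_eq_zero n (k + 1 + n) (by omega), hP.coeff_eq_zero n (k + 2 + n) (by omega),
        hP.coeff_eq_zero (n + 1) (k + 1 + n + 2) (by omega),
        hP.coeff_eq_zero (n + 2) (k + 1 + n + 2) (by omega)]
      simp
  · simp only [map_sub (momentPairing c (j : ℤ)), map_add (momentPairing c (j : ℤ)),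
      momentPairing.C_mul, momentPairing.logDerivOp c hc,
      hP.pairing (n + 2) j (by omega), hP.pairing (n + 1) j hj]
    -- At `j = n` the pairing of `P n` need not vanish; the eigenvalue `n` of the pairing rule is
    -- cancelled by the term `C n * P n`.
    rcases (Nat.le_of_lt_succ hj).eq_or_lt with rfl | hj
    · simp
    · simp [hP.pairing n j hj]

/-- The term in `R (n + 1)` matches the constant coefficient `a`, and the term in `P (n + 1)`
matches degree `n + 2`. The last term corrects the pairing at index `n + 1`, the only one among `1,
…, n + 1` where `R n` may fail to be orthogonal. -/
lemma logDerivOp_reversed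
    (hc : ∀ j : ℤ, a * c j + b * c (j - 1) + d * c (j - 2) = (j : A) * c j) (n : ℕ) :
    logDerivOp a b d (R n) = C ((R n).coeff n * d) * P (n + 1) * X + C a * R (n + 1)
      - C ((n + 1 : A) * (R (n + 1)).coeff (n + 1)) * P n * X := by
  rw [← sub_eq_zero]
  refine hN.eq_zero_of_shift (n + 1) _ ?_ (fun k hk => ?_) fun j hj => ?_
  · simp [logDerivOp, hR.coeff_zero, pow_two, ← mul_assoc]
  · obtain ⟨k, rfl⟩ := Nat.exists_eq_add_of_le' hk
    have hd : (derivative (R n) * X).coeff (k + (n + 1) + 1) = 0 := by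
      simp [coeff_derivative, hR.coeff_eq_zero n (k + (n + 1) + 1) (by omega)]
    rw [coeff_sub]
    unfold logDerivOp
    simp only [coeff_add, coeff_sub, hd, coeff_C_mul, coeff_mul_C, coeff_mul_X, pow_two,
      ← mul_assoc]
    rw [← add_assoc, coeff_mul_X, coeff_mul_C, hR.coeff_eq_zero n (k + n + 1) (by omega),
      hR.coeff_eq_zero n (k + n + 1 + 1) (by omega),
      hR.coeff_eq_zero (n + 1) (k + n + 1 + 1) (by omega),
      hP.coeff_eq_zero n (k + n + 1) (by omega)]
    rcases k with _ | k
    · simp [hP.coeff_self]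
    · simp [hP.coeff_eq_zero (n + 1) (k + 1 + n + 1) (by omega),
        hR.coeff_eq_zero n (k + 1 + n) (by omega)]
  · have hR1 := hR.pairing (n + 1) j hj
    simp only [map_sub, map_add, momentPairing.C_mul, momentPairing.mul_X,
      momentPairing.logDerivOp c hc, add_sub_cancel_right, hP.pairing (n + 1) j hj, hR1]
    rcases (Nat.le_of_lt_succ hj).eq_or_lt with rfl | hj
    -- Orthogonality of the next reversed polynomial expresses the boundary pairing of `R j` through
    -- that of `P j`.
    · rw [szego_recursion_reversed hN hP hR j] at hR1
      simp only [map_add, momentPairing.C_mul, momentPairing.mul_X, add_sub_cancel_right] at hR1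
      rw [eq_neg_of_add_eq_zero_left hR1]
      push_cast
      noncomm_ring
    · simp [hP.pairing n j hj, hR.pairing n j hj]

lemma verblunsky_relation_left
    (hc : ∀ j : ℤ, a * c j + b * c (j - 1) + d * c (j - 2) = (j : A) * c j) {α β : ℕ → A}
    (hα : ∀ n, α n = (P n).coeff 0) (hβ : ∀ n, β n = (R n).coeff n) (n : ℕ) :
    b * α (n + 1) + d * α (n + 2) - α n * (a - n)
        = d * (α (n + 2) * β (n + 1) * α (n + 1) + α (n + 1) * β n * α (n + 1))
          + ⁅d, ∑ m ∈ Finset.Icc 1 n, α m * β (m - 1)⁆ * α (n + 1) := by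
  have h := congrArg (fun p => coeff p 0) (logDerivOp_orthogonal hN hP hR hc n)
  simp only [logDerivOp, coeff_add, mul_coeff_zero, coeff_X_zero, coeff_C_zero,
    pow_two, mul_zero, zero_add, add_zero, ← hα, ← hβ] at h
  rw [mul_sub, h, Ring.lie_def, Finset.sum_Icc_succ_top (by omega : 1 ≤ n + 1 + 1),
    Finset.sum_Icc_succ_top (by omega : 1 ≤ n + 1), (Nat.cast_commute n (α n)).eq]
  simp only [Nat.add_sub_cancel]
  noncomm_ring

lemma verblunsky_relation_right
    (hc : ∀ j : ℤ, a * c j + b * c (j - 1) + d * c (j - 2) = (j : A) * c j) {α β : ℕ → A}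
    (hα : ∀ n, α n = (P n).coeff 0) (hβ : ∀ n, β n = (R n).coeff n) (n : ℕ) :
    β (n + 1) * b + β n * d - (a - (n + 2)) * β (n + 2)
        = (β (n + 1) * α (n + 1) * β n + β (n + 1) * α (n + 2) * β (n + 1)) * d
          + β (n + 1) * ⁅d, ∑ m ∈ Finset.Icc 1 (n + 2), α m * β (m - 1)⁆ := by
  have h := congrArg (fun p => coeff p (n + 2)) (logDerivOp_reversed hN hP hR hc (n + 1))
  have hd : (derivative (R (n + 1)) * X).coeff (n + 2) = 0 := by
    simp [coeff_derivative, hR.coeff_eq_zero (n + 1) (n + 2) (by omega)]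
  have hr := reversed_coeff_pred hN hP hR n
  have hp := coeff_pred_eq_sum hN hP hR (n + 1)
  have e0 := hR.coeff_eq_zero (n + 1) (n + 2) (by omega)
  have e1 := hP.coeff_self (n + 1)
  simp only [← hα, ← hβ] at hr hp
  simp only [logDerivOp, coeff_add, coeff_sub, coeff_C_mul, coeff_mul_C, hd, coeff_mul_X_pow,
    coeff_mul_X, hr, hp, e0, e1, ← hβ] at h
  rw [zero_mul, zero_add, zero_add] at h
  have h' := eq_sub_of_add_eq h
  rw [h', Ring.lie_def, Finset.sum_Icc_succ_top (by omega : 1 ≤ n + 1 + 1),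
    Finset.sum_Icc_succ_top (by omega : 1 ≤ n + 1)]
  simp only [Nat.add_sub_cancel]
  push_cast
  noncomm_ring

end SzegoAlgebra
-- From integrals over the circle to moments.
section CircleMean

variable {N : ℕ} {w : ℂ → Matrix (Fin N) (Fin N) ℂ}

lemma circleMean_congr {ι κ : Type*} {F G : ℂ → Matrix ι κ ℂ} (h : ∀ ζ : ℂ, ‖ζ‖ = 1 → F ζ = G ζ) :
    circleMean F = circleMean G := by
  ext i j
  simp only [circleMean, Matrix.of_apply]
  congr 1
  refine circleIntegral.integral_congr zero_le_one fun ζ hζ => ?_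
  simp only [h ζ (by simpa using hζ)]

lemma circleMean_sum_mul {F : ℕ → ℂ → Matrix (Fin N) (Fin N) ℂ} (s : Finset ℕ)
    (a : ℕ → Matrix (Fin N) (Fin N) ℂ)
    (hF : ∀ k i j, ContinuousOn (fun ζ => F k ζ i j) (Metric.sphere 0 1)) :
    circleMean (fun ζ => ∑ k ∈ s, a k * F k ζ) = ∑ k ∈ s, a k * circleMean (F k) := by
  have hi : ContinuousOn (fun ζ : ℂ => ζ⁻¹) (Metric.sphere 0 1) :=
    continuousOn_id.inv₀ fun ζ hζ h => by
      rw [id] at h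
      simp [h] at hζ
  have hI : ∀ k i j (b : ℂ), CircleIntegrable (fun ζ => b * (ζ⁻¹ * F k ζ i j)) 0 1 := fun k i j b =>
    (continuousOn_const.mul (hi.mul (hF k i j))).circleIntegrable zero_le_one
  ext i j
  simp only [circleMean, Matrix.of_apply, Matrix.sum_apply, Matrix.mul_apply, Finset.mul_sum]
  have e : ∀ (ζ : ℂ) k l, ζ⁻¹ * (a k i l * F k ζ l j) = a k i l * (ζ⁻¹ * F k ζ l j) := by
    intros; ring
  simp only [e]
  rw [circleIntegral.integral_fun_sum fun k _ => CircleIntegrable.fun_sum _ fun l _ => hI k l j _,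
    Finset.mul_sum]
  refine Finset.sum_congr rfl fun k _ => ?_
  rw [circleIntegral.integral_fun_sum fun l _ => hI k l j _, Finset.mul_sum]
  refine Finset.sum_congr rfl fun l _ => ?_
  rw [circleIntegral.integral_const_mul]
  ring

lemma IsHolomorphicWeight.continuousOn_zpow_smul (hw : IsHolomorphicWeight w) (e : ℤ)
    (i j : Fin N) :
    ContinuousOn (fun ζ => ((starRingEnd ℂ ζ) ^ e • w ζ) i j) (Metric.sphere 0 1) := by
  have h0 : ∀ ζ ∈ Metric.sphere (0 : ℂ) 1, ζ ≠ 0 := fun ζ hζ h => by simp [h] at hζ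
  have h1 : ContinuousOn (fun ζ => w ζ i j) (Metric.sphere 0 1) :=
    (hw.1 i j).continuousOn.mono fun ζ hζ => h0 ζ hζ
  have h2 : ContinuousOn (fun ζ : ℂ => (starRingEnd ℂ ζ) ^ e) (Metric.sphere 0 1) :=
    Complex.continuous_conj.continuousOn.zpow₀ e fun ζ hζ =>
      Or.inl ((map_ne_zero _).2 (h0 ζ hζ))
  exact h2.mul h1

lemma circleMean_sum_mul_weight (hw : IsHolomorphicWeight w) (s : Finset ℕ)
    (a : ℕ → Matrix (Fin N) (Fin N) ℂ) (e : ℕ → ℤ) :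
    circleMean (fun ζ => ∑ k ∈ s, a k * ((starRingEnd ℂ ζ) ^ e k • w ζ)) =
      ∑ k ∈ s, a k * weightMoment w (e k) :=
  circleMean_sum_mul s a fun k i j => hw.continuousOn_zpow_smul (e k) i j

lemma matPolyEval_eq_sum (P : (Matrix (Fin N) (Fin N) ℂ)[X]) (z : ℂ) {n : ℕ}
    (h : P.natDegree < n) : matPolyEval P z = ∑ k ∈ Finset.range n, z ^ k • P.coeff k := by
  rw [matPolyEval, Polynomial.eval_eq_sum_range' h]
  refine Finset.sum_congr rfl fun k _ => ?_
  rw [← map_pow, Matrix.scalar_apply, ← Matrix.smul_one_eq_diagonal, mul_smul_comm, mul_one]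

lemma verblunsky_eq_coeff_zero (P : (Matrix (Fin N) (Fin N) ℂ)[X]) :
    verblunsky P = P.coeff 0 := by
  rw [verblunsky, matPolyEval_eq_sum P 0 (Nat.lt_succ_self _), Finset.sum_range_succ']
  simp

lemma conj_ne_zero_of_norm_one {ζ : ℂ} (h : ‖ζ‖ = 1) : starRingEnd ℂ ζ ≠ 0 :=
  (map_ne_zero _).2 fun h0 => by simp [h0] at h

lemma eq_conj_inv_of_norm_one {ζ : ℂ} (h : ‖ζ‖ = 1) : ζ = (starRingEnd ℂ ζ)⁻¹ := by
  rw [Complex.inv_def]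
  simp [Complex.normSq_eq_norm_sq, h]

lemma circleMean_matPolyEval_mul (hw : IsHolomorphicWeight w) (P : (Matrix (Fin N) (Fin N) ℂ)[X])
    (j : ℕ) : circleMean (fun ζ => (starRingEnd ℂ ζ) ^ j • (matPolyEval P ζ * w ζ)) =
      momentPairing (weightMoment w) j P := by
  rw [momentPairing.apply_eq_sum_range _ P _ (Nat.lt_succ_self _), ← circleMean_sum_mul_weight hw]
  refine circleMean_congr fun ζ hζ => ?_
  rw [matPolyEval_eq_sum P ζ (Nat.lt_succ_self _), Finset.sum_mul, Finset.smul_sum]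
  refine Finset.sum_congr rfl fun k _ => ?_
  rw [smul_mul_assoc, smul_smul, mul_smul_comm]
  congr 1
  nth_rw 2 [eq_conj_inv_of_norm_one hζ]
  rw [zpow_sub₀ (conj_ne_zero_of_norm_one hζ), inv_pow, zpow_natCast, zpow_natCast, div_eq_mul_inv]

/-- The reversed adjoint polynomial `zⁿ Q(1/z̄)†` of a polynomial `Q` of degree at most `n`. -/
noncomputable def reversedAdjoint (n : ℕ) (Q : (Matrix (Fin N) (Fin N) ℂ)[X]) :
    (Matrix (Fin N) (Fin N) ℂ)[X] :=
  ∑ k ∈ Finset.range (n + 1), Polynomial.monomial k (Q.coeff (n - k))ᴴ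

lemma reversedAdjoint_coeff (n : ℕ) (Q : (Matrix (Fin N) (Fin N) ℂ)[X]) (k : ℕ) :
    (reversedAdjoint n Q).coeff k = if k ≤ n then (Q.coeff (n - k))ᴴ else 0 := by
  simp [reversedAdjoint, Polynomial.coeff_monomial]

/-- On the circle `Q(ζ)†` is `ζ⁻ⁿ` times the reversed adjoint. Orthogonality for `j = 0, …, n - 1`
thus becomes orthogonality of the reversed adjoint to the powers `1, …, n`. -/
lemma circleMean_matPolyEval_conjTranspose_mul (hw : IsHolomorphicWeight w) {n : ℕ}
    (Q : (Matrix (Fin N) (Fin N) ℂ)[X]) (hQ : Q.natDegree ≤ n) (j : ℕ) :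
    circleMean (fun ζ => ζ ^ j • ((matPolyEval Q ζ)ᴴ * w ζ)) =
      momentPairing (weightMoment w) (n - j : ℤ) (reversedAdjoint n Q) := by
  simp only [reversedAdjoint, map_sum, momentPairing.apply_monomial]
  rw [← Finset.sum_range_reflect, ← circleMean_sum_mul_weight hw]
  refine circleMean_congr fun ζ hζ => ?_
  rw [matPolyEval_eq_sum Q ζ (Nat.lt_succ_of_le hQ), Matrix.conjTranspose_sum, Finset.sum_mul,
    Finset.smul_sum]
  refine Finset.sum_congr rfl fun k hk => ?_
  have hk : k ≤ n := Nat.lt_succ_iff.1 (Finset.mem_range.1 hk)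
  rw [Matrix.conjTranspose_smul, smul_mul_assoc, smul_smul, mul_smul_comm,
    show n - (n + 1 - 1 - k) = k by omega]
  congr 1
  rw [show (n - j : ℤ) - ((n + 1 - 1 - k : ℕ) : ℤ) = k - j by push_cast [hk]; ring]
  nth_rw 1 [eq_conj_inv_of_norm_one hζ]
  rw [zpow_sub₀ (conj_ne_zero_of_norm_one hζ), inv_pow, zpow_natCast, zpow_natCast, div_eq_mul_inv,
    star_pow, mul_comm]
  rfl

/-- Each matrix row, collected over the coefficients of `S`, is a left null vector of the right
moment matrix, whose blocks are indexed by `j - k` exactly as in the pairing. -/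
lemma IsQuasiDefinite.momentNondegenerate (hqd : IsQuasiDefinite w) :
    MomentNondegenerate (weightMoment w) := by
  intro n S hS h
  rcases n.eq_zero_or_pos with rfl | hn
  · ext1 k
    simpa using hS k (Nat.zero_le k)
  have hcoeff : ∀ k < n, S.coeff k = 0 := by
    intro k hk
    ext i l
    have hv : Matrix.vecMul (fun p : Fin n × Fin N => S.coeff p.1 i p.2)
        (rightMomentMatrix w n) = 0 := by
      ext ⟨q, l⟩
      have hq := congrFun (congrFun (h q q.2) i) l
      have hd : S.natDegree < n :=
        (Nat.lt_iff_le_pred hn).2 (Polynomial.natDegree_le_iff_coeff_eq_zero.2 fun k hk =>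
          hS k (by omega))
      rw [momentPairing.apply_eq_sum_range _ S _ hd, Finset.sum_range] at hq
      simpa [Matrix.vecMul, dotProduct, rightMomentMatrix, Fintype.sum_prod_type,
        Matrix.sum_apply, Matrix.mul_apply] using hq
    exact congrFun (Matrix.eq_zero_of_vecMul_eq_zero (hqd n hn).2 hv) (⟨k, hk⟩, l)
  ext1 k
  rcases lt_or_ge k n with hk | hk
  · simpa using hcoeff k hk
  · simpa using hS k hk

/-- The recurrence for the moments given by the Pearson equation
`z w'(z) = (a + b z + d z²) w(z)`. -/
lemma weightMoment_recurrence (hw : IsHolomorphicWeight w) {a b d : Matrix (Fin N) (Fin N) ℂ}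
    (hW : ∀ z : ℂ, z ≠ 0 → rightLogDeriv w z = z⁻¹ • a + b + z • d) (j : ℤ) :
    a * weightMoment w j + b * weightMoment w (j - 1) + d * weightMoment w (j - 2) =
      (j : Matrix (Fin N) (Fin N) ℂ) * weightMoment w j := by
  have h0 : ∀ ζ : ℂ, ‖ζ‖ = 1 → ζ ≠ 0 := fun ζ hζ h => by simp [h] at hζ
  have hderiv : ∀ z : ℂ, z ≠ 0 → Matrix.of (fun i l => deriv (fun ζ => w ζ i l) z) =
      (z⁻¹ • a + b + z • d) * w z := fun z hz => by
    rw [← hW z hz, rightLogDeriv, mul_assoc,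
      Matrix.nonsing_inv_mul _ ((Matrix.isUnit_iff_isUnit_det _).1 (hw.2 z hz)), mul_one]
  -- The four terms of the recurrence are packed into one sum so that linearity of `circleMean`
  -- applies at once. On the circle the integrand is `ζ` times the derivative of `ζ^(-j) w`; this
  -- factor `ζ` cancels the `ζ⁻¹` of the measure.
  have hzero : circleMean (fun ζ => ∑ k ∈ Finset.range 4,
      (![-(j : Matrix (Fin N) (Fin N) ℂ), a, b, d] (Fin.ofNat 4 k)) *
        ((starRingEnd ℂ ζ) ^ (![j, j, j - 1, j - 2] (Fin.ofNat 4 k)) • w ζ)) = 0 := by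
    rw [circleMean_congr (G := fun ζ => ζ • ((-j * ζ ^ (-j - 1)) • w ζ +
      ζ ^ (-j) • Matrix.of (fun i l => deriv (fun ζ => w ζ i l) ζ)))]
    · ext i l
      simp only [circleMean, Matrix.of_apply, Matrix.zero_apply]
      rw [circleIntegral.integral_congr zero_le_one
        (g := fun ζ => (-j * ζ ^ (-j - 1)) * w ζ i l + ζ ^ (-j) * deriv (fun ζ => w ζ i l) ζ),
        circleIntegral.integral_eq_zero_of_hasDerivWithinAt (f := fun ζ => ζ ^ (-j) * w ζ i l)
          zero_le_one, mul_zero]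
      · intro ζ hζ
        have hζ : ζ ≠ 0 := h0 ζ (by simpa using hζ)
        have h1 := hasDerivAt_zpow (-j) ζ (Or.inl hζ)
        have h2 := ((hw.1 i l).differentiableAt (isOpen_compl_singleton.mem_nhds hζ)).hasDerivAt
        simpa using! (h1.mul h2).hasDerivWithinAt (s := Metric.sphere 0 1)
      · intro ζ hζ
        have hζ : ζ ≠ 0 := h0 ζ (by simpa using hζ)
        simp [hζ]
    · intro ζ hζ
      have hc := conj_ne_zero_of_norm_one hζ
      rw [hderiv ζ (h0 ζ hζ), show starRingEnd ℂ ζ = ζ⁻¹ by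
        conv_rhs => rw [eq_conj_inv_of_norm_one hζ]
        rw [inv_inv]]
      have hz := h0 ζ hζ
      simp only [Finset.sum_range_succ, Finset.sum_range_zero, inv_zpow']
      have e1 : ζ ^ (1 - j) = ζ * ζ ^ (-j) := by rw [sub_eq_add_neg, zpow_add₀ hz, zpow_one]
      have e2 : ζ ^ (2 - j) = ζ * ζ * ζ ^ (-j) := by
        rw [sub_eq_add_neg, zpow_add₀ hz]; norm_cast; rw [pow_two]
      have e3 : ζ * (-j * ζ ^ (-j - 1)) = -j * ζ ^ (-j) := by
        rw [zpow_sub_one₀ hz]; field_simp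
      have e4 : (j : Matrix (Fin N) (Fin N) ℂ) * w ζ = (j : ℂ) • w ζ := by
        rw [← Int.smul_one_eq_cast, smul_mul_assoc, one_mul, Int.cast_smul_eq_zsmul]
      have e5 : ζ * (ζ ^ (-j) * ζ⁻¹) = ζ ^ (-j) := by field_simp
      simp only [Fin.ofNat, smul_add, smul_smul, e3, add_mul, smul_mul_assoc, e5, mul_smul_comm]
      simp [e1, e2, e4, smul_smul]
      simp only [mul_comm, mul_assoc, add_assoc]
  rw [circleMean_sum_mul_weight hw _ (fun k => ![-(j : Matrix (Fin N) (Fin N) ℂ), a, b, d]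
    (Fin.ofNat 4 k)) (fun k => ![j, j, j - 1, j - 2] (Fin.ofNat 4 k))] at hzero
  simp [Finset.sum_range_succ, Fin.ofNat] at hzero
  rw [← sub_eq_zero, ← hzero]
  abel

end CircleMean

/-! ### Specialization to the matrix Szegő polynomials. -/

theorem mainTheorem5 {N : ℕ} (w : ℂ → Matrix (Fin N) (Fin N) ℂ)
    (hw : IsHolomorphicWeight w) (hqd : IsQuasiDefinite w)
    (Wneg1 W0 W1 : Matrix (Fin N) (Fin N) ℂ)
    (hdiag : IsDiagonalizableInt Wneg1)
    (hW : ∀ z : ℂ, z ≠ 0 → rightLogDeriv w z = z⁻¹ • Wneg1 + W0 + z • W1)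
    (P1L P2R : ℕ → (Matrix (Fin N) (Fin N) ℂ)[X])
    (hP1L : ∀ n, IsLeftSzegoOne w n (P1L n))
    (hP2R : ∀ n, IsRightSzegoTwo w n (P2R n))
    (α β : ℕ → Matrix (Fin N) (Fin N) ℂ)
    (hα : ∀ n, α n = verblunsky (P1L n))
    (hβ : ∀ n, β n = (verblunsky (P2R n))ᴴ)
    (n : ℕ) (hn : 1 ≤ n) :
    W0 * α n + W1 * α (n + 1) - α (n - 1) * (Wneg1 - ((n : ℂ) - 1) • 1)
        = W1 * (α (n + 1) * β n * α n + α n * β (n - 1) * α n)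
          + ⁅W1, ∑ m ∈ Finset.Icc 1 (n - 1), α m * β (m - 1)⁆ * α n
    ∧
    β n * W0 + β (n - 1) * W1 - (Wneg1 - ((n : ℂ) + 1) • 1) * β (n + 1)
        = (β n * α n * β (n - 1) + β n * α (n + 1) * β n) * W1
          + β n * ⁅W1, ∑ m ∈ Finset.Icc 1 (n + 1), α m * β (m - 1)⁆ := by
  have hP : IsMonicOrthogonal (weightMoment w) P1L :=
    { coeff_eq_zero := fun n k hk => Polynomial.coeff_eq_zero_of_natDegree_lt
        ((hP1L n).1.natDegree_eq.trans_lt hk)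
      coeff_self := fun n => by
        have h := (hP1L n).1.monic.coeff_natDegree
        rwa [(hP1L n).1.natDegree_eq] at h
      pairing := fun n j hj => by
        rw [← circleMean_matPolyEval_mul hw]
        exact (hP1L n).2 j hj }
  have hR : IsReversedOrthogonal (weightMoment w) fun n => reversedAdjoint n (P2R n) :=
    { coeff_eq_zero := fun n k hk => by simp [reversedAdjoint_coeff, hk]
      coeff_zero := fun n => by
        have h := (hP2R n).1.monic.coeff_natDegree
        rw [(hP2R n).1.natDegree_eq] at h
        simp [reversedAdjoint_coeff, h]
      pairing := fun n j hj => by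
        -- Reversal sends the power `n - 1 - j` to `n - (n - 1 - j) = j + 1`.
        have h := (hP2R n).2 (n - 1 - j) (by omega)
        rw [circleMean_matPolyEval_conjTranspose_mul hw _ (hP2R n).1.natDegree_eq.le] at h
        rwa [show (j + 1 : ℤ) = n - ((n - 1 - j : ℕ) : ℤ) by omega] }
  have hα' : ∀ n, α n = (P1L n).coeff 0 := fun n => by rw [hα, verblunsky_eq_coeff_zero]
  have hβ' : ∀ n, β n = (reversedAdjoint n (P2R n)).coeff n := fun n => by
    rw [hβ, verblunsky_eq_coeff_zero]
    simp [reversedAdjoint_coeff]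
  obtain ⟨n, rfl⟩ := Nat.exists_eq_add_of_le' hn
  have hc := weightMoment_recurrence hw hW
  have hN := hqd.momentNondegenerate
  have hcast : ∀ k : ℕ, (k : ℂ) • (1 : Matrix (Fin N) (Fin N) ℂ) = k := fun k => by
    rw [Nat.cast_smul_eq_nsmul, nsmul_one]
  have hl := verblunsky_relation_left hN hP hR hc hα' hβ' n
  have hr := verblunsky_relation_right hN hP hR hc hα' hβ' n
  rw [← hcast n] at hl
  rw [show (n + 2 : Matrix (Fin N) (Fin N) ℂ) = ((n + 2 : ℕ) : Matrix (Fin N) (Fin N) ℂ) by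
    push_cast; rfl, ← hcast (n + 2)] at hr
  refine ⟨?_, ?_⟩
  · simpa using hl
  · rw [show ((n + 1 : ℕ) : ℂ) + 1 = ((n + 2 : ℕ) : ℂ) by push_cast; ring]
    exact hr
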